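/- Let $r\in\mathbb{N}_0$ and $m\in\mathbb{N}$ with $m\ge r+2$, and let $0<\lambda\le 1$. Let $X=\{x_j\}_{j=0}^{m-1}$ be real points, possibly with repetitions, such that $x_0\le x_1\le\dots\le x_{m-1}$ and $x_0<x_{m-1}$. Put $I:=[x_0,x_{m-1}]$ and $|I|:=x_{m-1}-x_0$, and suppose that \[ x_{j+r+1}-x_j\ge\lambda|I|\qquad\text{for all } 0\le j\le m-r-2 . \] Let $f\in C^{(r)}(I)$ be real valued. Define the divided differences of $f$ at consecutive knots by $[x_i;f]:=f(x_i)$ and, for $n\ge1$, \[ [x_i,\dots,x_{i+n};f]:= \begin{cases} \dfrac{f^{(n)}(x_i)}{n!}, & x_i=x_{i+n},\\[2mm] \dfrac{[x_{i+1},\dots,x_{i+n};f]-[x_i,\dots,x_{i+n-1};f]}{x_{i+n}-x_i}, & x_i<x_{i+n}, \end{cases} \] (derivatives at the end points of $I$ are one-sided), and set \[ L_{m-1}(x;f;X):=\sum_{j=0}^{m-1}[x_0,\dots,x_j;f]\,(x-x_0)\cdots(x-x_{j-1}) . \] Then $L_{m-1}(\cdot;f;X)$ is the Hermite interpolation polynomial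 of $f$ at $X$, that is, it has degree at most $m-1$ and $L_{m-1}^{(l_j-1)}(x_j;f;X)=f^{(l_j-1)}(x_j)$ for all $0\le j\le m-1$, where $l_j$ is the number of indices $i\le j$ with $x_i=x_j$; and \[ \bigl|f(x)-L_{m-1}(x;f;X)\bigr|\le C(m,\lambda)\,|I|^r\,\omega_{m-r}\bigl(f^{(r)},|I|,I\bigr),\qquad x\in I, \] where the constant $C(m,\lambda)$ depends only on $m$ and $\lambda$. Here, for $k\in\mathbb{N}$, $t>0$ and $g\in C[a,b]$, $\omega_k(g,t,[a,b])$ is the $k$th modulus of smoothness \[ \omega_k(g,t,[a,b]):=\sup_{0<u\le t}\ \sup_{y\in[a,b]}\bigl|\Delta_u^k(g,y;[a,b])\bigr|, \] with $\Delta_u^k(g,y;[a,b]):=\sum_{i=0}^k(-1)^i\binom ki g\bigl(y+(k/2-i)u\bigr)$ if $y\pm(k/2)u\in[a,b]$, and $\Delta_u^k(g,y;[a,b]):=0$ otherwise. -/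

import Mathlib

noncomputable section

namespace WhitneyHermite

/-- The `k`-th symmetric difference of `g` with step `u` at the point `y`, relative to `[a, b]`:
`∑_{i=0}^k (-1)^i (k choose i) g (y + (k/2 - i) u)` if `y ± (k/2) u ∈ [a, b]`, and `0` otherwise. -/
def centralDiff (k : ℕ) (g : ℝ → ℝ) (a b u y : ℝ) : ℝ :=
  open Classical in
  if y - (k : ℝ) / 2 * u ∈ Set.Icc a b ∧ y + (k : ℝ) / 2 * u ∈ Set.Icc a b then
    ∑ i ∈ Finset.range (k + 1),
      (-1 : ℝ) ^ i * (k.choose i : ℝ) * g (y + ((k : ℝ) / 2 - (i : ℝ)) * u)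
  else 0

/-- The `k`-th modulus of smoothness `ω_k(g, t; [a, b])`: the supremum, over all steps
`0 < u ≤ t` and all points `y ∈ [a, b]`, of the absolute value of the `k`-th symmetric difference.
For `g` continuous on `[a, b]`, `a ≤ b` and `t > 0`, the set is nonempty and bounded above. -/
def modulus (k : ℕ) (g : ℝ → ℝ) (t a b : ℝ) : ℝ :=
  sSup {v : ℝ | ∃ u y : ℝ, 0 < u ∧ u ≤ t ∧ y ∈ Set.Icc a b ∧ v = |centralDiff k g a b u y|}

/-- The Lagrange-Hermite divided difference `[x_i, …, x_{i+n}; f]` of order `n` at knots numbered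
from left to right, `x_i ≤ … ≤ x_{i+n}` (so the knots all coincide exactly when
`x_i = x_{i+n}`). Derivatives of `f` are taken within the set `I` (one-sided at its end points). -/
def dividedDiff (f : ℝ → ℝ) (I : Set ℝ) (x : ℕ → ℝ) : ℕ → ℕ → ℝ
  | 0, i => f (x i)
  | n + 1, i =>
    open Classical in
    if x i = x (i + (n + 1)) then iteratedDerivWithin (n + 1) f I (x i) / ((n + 1).factorial : ℝ)
    else (dividedDiff f I x n (i + 1) - dividedDiff f I x n i) / (x (i + (n + 1)) - x i)

/-- The Hermite polynomial `L_{m-1}(·; f; x_0, …, x_{m-1})` for the `m` knots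
`x_0 ≤ … ≤ x_{m-1}`, in Newton form:
`∑_{j=0}^{m-1} [x_0, …, x_j; f] (X - x_0) ⋯ (X - x_{j-1})`. -/
def hermitePoly (f : ℝ → ℝ) (I : Set ℝ) (x : ℕ → ℝ) (m : ℕ) : Polynomial ℝ :=
  ∑ j ∈ Finset.range m, Polynomial.C (dividedDiff f I x j 0) *
    ∏ i ∈ Finset.range j, (Polynomial.X - Polynomial.C (x i))

/-- The number of indices `i < j` with `x_i = x_j`: the order of the derivative that is
interpolated at the knot `x_j`. -/
def knotOrder (x : ℕ → ℝ) (j : ℕ) : ℕ :=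
  open Classical in
  ((Finset.range j).filter (fun i => x i = x j)).card

/-- `P` solves the Hermite interpolation problem for `f` at the `m` knots `x_0, …, x_{m-1}`:
`P` has degree less than `m`, and at a knot of multiplicity `μ` the values and the derivatives
of `P` and `f` agree up to order `μ - 1`. -/
def IsHermiteInterpolant (P : Polynomial ℝ) (f : ℝ → ℝ) (I : Set ℝ) (x : ℕ → ℝ) (m : ℕ) : Prop :=
  P.degree < (m : WithBot ℕ) ∧
    ∀ j < m, (Polynomial.derivative^[knotOrder x j] P).eval (x j) =
      iteratedDerivWithin (knotOrder x j) f I (x j)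

end WhitneyHermite

end

namespace WhitneyHermite

open Polynomial

/-! Interpolation at m knots reproduces every polynomial Q of degree less than m, so the error for f
is that for f - Q. It suffices to find Q close to f and to show that Hermite interpolation at these
knots is stable. Whitney's theorem gives q of degree less than m - r with |f^(r) - q| ≤ E on I,
where E is a multiple of the modulus; r integrations give Q with |(f - Q)^(l)| ≤ E |I|^(r-l) for l ≤
r (`exists_polynomial_of_abs_deriv_sub_le`). Divided differences of f - Q of order at most r are
bounded by Rolle's theorem, those of higher order by the recursion, whose denominators are then at
least λ|I| (`abs_newtonCoeff_mul_pow_le`). Newton's form turns this into a bound for the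
interpolant.

Whitney's theorem (`exists_polynomial_abs_sub_le_modulus`) goes by induction on the order: g is
close to an average of its translates, whose derivative is a combination of first differences of g.
This induction needs mixed differences; on a short interval Kemperman's lemma bounds them by pure
ones. Pure differences then carry the estimate to the whole interval.

Divided differences only see finitely many derivatives at the knots, so f may be replaced by a
polynomial F with the same data. Its interpolant is the remainder of F modulo the node polynomial,
and the rules for divided differences become statements about divisibility. -/

/-! ### Finite differences. -/

/-- The mixed difference `Δ_{h 0} ⋯ Δ_{h (n - 1)} g (x)`. -/
def mixedDiff : ℕ → (ℕ → ℝ) → (ℝ → ℝ) → ℝ → ℝ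
  | 0, _, g, x => g x
  | n + 1, h, g, x => mixedDiff n h g (x + h n) - mixedDiff n h g x

/-- The alternating binomial sum `∑ (-1)^i (k choose i) g (y + i a)`. -/
def altDiff (k : ℕ) (g : ℝ → ℝ) (y a : ℝ) : ℝ :=
  ∑ i ∈ Finset.range (k + 1), (-1 : ℝ) ^ i * (k.choose i : ℝ) * g (y + i * a)

theorem mixedDiff_sub (n : ℕ) (h : ℕ → ℝ) (f g : ℝ → ℝ) (x : ℝ) :
    mixedDiff n h (fun y => f y - g y) x = mixedDiff n h f x - mixedDiff n h g x := by
  induction n generalizing x with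
  | zero => rfl
  | succ n ih => simp only [mixedDiff, ih]; ring

theorem mixedDiff_sum {ι : Type*} (s : Finset ι) (c : ι → ℝ) (n : ℕ) (h : ℕ → ℝ)
    (f : ι → ℝ → ℝ) (x : ℝ) :
    mixedDiff n h (fun y => ∑ j ∈ s, c j * f j y) x = ∑ j ∈ s, c j * mixedDiff n h (f j) x := by
  induction n generalizing x with
  | zero => rfl
  | succ n ih => simp only [mixedDiff, ih, ← Finset.sum_sub_distrib, mul_sub]

theorem mixedDiff_shift (n : ℕ) (h : ℕ → ℝ) (g : ℝ → ℝ) (v x : ℝ) :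
    mixedDiff n h (fun y => g (y + v)) x = mixedDiff n h g (x + v) := by
  induction n generalizing x with
  | zero => rfl
  | succ n ih => simp only [mixedDiff, ih, add_right_comm]

theorem mixedDiff_congr {n : ℕ} {h h' : ℕ → ℝ} (H : ∀ j < n, h j = h' j) (g : ℝ → ℝ) (x : ℝ) :
    mixedDiff n h g x = mixedDiff n h' g x := by
  induction n generalizing x with
  | zero => rfl
  | succ n ih =>
    simp only [mixedDiff, ih fun j hj => H j (hj.trans n.lt_succ_self), H n n.lt_succ_self]

theorem mixedDiff_eq_zero {n j : ℕ} {h : ℕ → ℝ} (hj : j < n) (h0 : h j = 0) (g : ℝ → ℝ)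
    (x : ℝ) : mixedDiff n h g x = 0 := by
  induction n generalizing x with
  | zero => omega
  | succ n ih =>
    rcases Nat.lt_succ_iff_lt_or_eq.1 hj with hlt | rfl
    · simp [mixedDiff, ih hlt]
    · simp [mixedDiff, h0]

theorem mixedDiff_const (n : ℕ) (u : ℝ) (g : ℝ → ℝ) (x : ℝ) :
    mixedDiff n (fun _ => u) g x = (fwdDiff u)^[n] g x := by
  induction n generalizing x with
  | zero => rfl
  | succ n ih => simp only [mixedDiff, ih, Function.iterate_succ_apply', fwdDiff]

theorem altDiff_eq_fwdDiff (k : ℕ) (g : ℝ → ℝ) (y a : ℝ) :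
    altDiff k g y a = (-1) ^ k * (fwdDiff a)^[k] g y := by
  rw [fwdDiff_iter_eq_sum_shift, altDiff, Finset.mul_sum]
  refine Finset.sum_congr rfl fun i hi => ?_
  have hi : i ≤ k := Nat.lt_succ_iff.1 (Finset.mem_range.1 hi)
  obtain ⟨d, rfl⟩ := Nat.exists_eq_add_of_le hi
  have h1 : (-1 : ℝ) ^ (i + d) * (-1) ^ d = (-1) ^ i := by
    rw [pow_add, mul_assoc, ← mul_pow]; simp
  simp only [Nat.add_sub_cancel_left, nsmul_eq_mul, zsmul_eq_mul]
  push_cast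
  rw [← h1]; ring

theorem altDiff_sub (k : ℕ) (f g : ℝ → ℝ) (y a : ℝ) :
    altDiff k (fun t => f t - g t) y a = altDiff k f y a - altDiff k g y a := by
  simp only [altDiff, mul_sub, Finset.sum_sub_distrib]

theorem altDiff_polynomial {k : ℕ} {p : ℝ[X]} (hp : p.degree < k) (y a : ℝ) :
    altDiff k (fun t => p.eval t) y a = 0 := by
  rcases eq_or_ne p 0 with rfl | hp0
  · simp [altDiff]
  have hk : p.natDegree < k := (natDegree_lt_iff_degree_lt hp0).2 hp
  have h1 : (p.comp (C a * X + C y)).natDegree < k := by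
    refine lt_of_le_of_lt natDegree_comp_le ?_
    calc _ ≤ p.natDegree * 1 := Nat.mul_le_mul_left _ (by compute_degree)
      _ < k := by simpa using hk
  have h2 := altDiff_eq_fwdDiff k (fun t => (p.comp (C a * X + C y)).eval t) 0 1
  have h3 : (fwdDiff (1 : ℝ))^[k] (fun t => (p.comp (C a * X + C y)).eval t) = 0 :=
    Polynomial.fwdDiff_iter_eq_zero_of_degree_lt h1
  rw [h3] at h2
  rw [← mul_zero ((-1 : ℝ) ^ k)]
  refine Eq.trans ?_ h2
  refine Finset.sum_congr rfl fun i _ => ?_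
  simp [add_comm y, mul_comm a]

/-! ### Kemperman's lemma. -/

/-- Swapping a weighted sum with a mixed difference whose steps depend linearly on the summation
index, at points where all nodes stay in `[0, 1]`. -/
theorem abs_sum_mixedDiff_le {k : ℕ} {w : ℕ → ℝ} {f : ℝ → ℝ} {M : ℝ}
    (H : ∀ y a : ℝ, a ≤ 0 → y ≤ 1 → 0 ≤ y + k * a →
      |∑ i ∈ Finset.range (k + 1), w i * f (y + i * a)| ≤ M)
    (h d : ℕ → ℝ) (hh : ∀ j, 0 ≤ h j) (hd : ∀ j, d j ≤ 0) (hdh : ∀ j, -h j ≤ d j)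
    (n : ℕ) (y a : ℝ) (ha : a ≤ 0) (hy : y + ∑ j ∈ Finset.range n, h j ≤ 1)
    (hya : 0 ≤ y + k * a - k * ∑ j ∈ Finset.range n, h j) :
    |∑ i ∈ Finset.range (k + 1), w i * mixedDiff n (fun j => h j + i * d j) f (y + i * a)| ≤
      2 ^ n * M := by
  induction n generalizing y a with
  | zero => simpa [mixedDiff] using H y a ha (by simpa using hy) (by simpa using hya)
  | succ n ih =>
    rw [Finset.sum_range_succ] at hy hya
    have hk : (0 : ℝ) ≤ k := k.cast_nonneg
    -- The last difference splits the sum into two of the same shape, one at `(y + h n, a + d n)`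
    -- and one at `(y, a)`; hence the factor `2 ^ n`.
    have h1 := ih (y + h n) (a + d n) (by linarith [hd n]) (by linarith) (by
      nlinarith [hdh n, hh n])
    have h2 := ih y a ha (by linarith [hh n]) (by nlinarith [hh n])
    have e : ∑ i ∈ Finset.range (k + 1),
        w i * mixedDiff (n + 1) (fun j => h j + i * d j) f (y + i * a) =
        (∑ i ∈ Finset.range (k + 1),
          w i * mixedDiff n (fun j => h j + i * d j) f (y + h n + i * (a + d n))) -
        ∑ i ∈ Finset.range (k + 1), w i * mixedDiff n (fun j => h j + i * d j) f (y + i * a) := by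
      rw [← Finset.sum_sub_distrib]
      refine Finset.sum_congr rfl fun i _ => ?_
      rw [mixedDiff, mul_sub]
      congr 3
      ring
    rw [e]
    refine (abs_sub _ _).trans ?_
    rw [pow_succ]; linarith

/-- Kemperman's lemma: pure differences control mixed differences. -/
theorem abs_mixedDiff_le_of_altDiff {k : ℕ} {f : ℝ → ℝ} {M : ℝ}
    (H : ∀ y a : ℝ, y ∈ Set.Icc (0 : ℝ) 1 → y + k * a ∈ Set.Icc (0 : ℝ) 1 → |altDiff k f y a| ≤ M)
    (h : ℕ → ℝ) (hh : ∀ j, 0 ≤ h j) (x : ℝ) (hx1 : x + ∑ j ∈ Finset.range k, h j ≤ 1)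
    (hx0 : 0 ≤ x - k * ∑ j ∈ Finset.range k, h j) :
    |mixedDiff k h f x| ≤ 2 ^ k * M := by
  have hk : (0 : ℝ) ≤ k := k.cast_nonneg
  -- For `d j = -(h j / (j + 1))` the step `h j + i * d j` vanishes at `i = j + 1`. So every term
  -- with `1 ≤ i ≤ k` is zero, and the term `i = 0` is the mixed difference.
  have key := abs_sum_mixedDiff_le (k := k) (w := fun i => (-1 : ℝ) ^ i * (k.choose i : ℝ))
    (f := f) (M := M) (fun y a ha hy hya => H y a ⟨by nlinarith, hy⟩ ⟨hya, by nlinarith⟩)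
    h (fun j => -(h j / (j + 1))) hh
    (fun j => neg_nonpos.2 (div_nonneg (hh j) (by positivity)))
    (fun j => neg_le_neg (div_le_self (hh j) (by simp)))
    k x 0 le_rfl hx1 (by simpa using hx0)
  rw [Finset.sum_range_succ', Finset.sum_eq_zero, zero_add] at key
  · simpa using key
  · intro i hi
    rw [mixedDiff_eq_zero (Finset.mem_range.1 hi), mul_zero]
    have : (i : ℝ) + 1 ≠ 0 := by positivity
    push_cast
    field_simp
    ring

/-! ### Whitney's theorem on the unit interval. -/

theorem exists_antiderivative {k : ℕ} {p : ℝ[X]} (hp : p.degree < k) (t₀ v : ℝ) :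
    ∃ P : ℝ[X], P.degree < ((k + 1 : ℕ) : WithBot ℕ) ∧ derivative P = p ∧ P.eval t₀ = v := by
  have key : ∃ P : ℝ[X], P.degree < ((k + 1 : ℕ) : WithBot ℕ) ∧ derivative P = p := by
    refine ⟨∑ i ∈ Finset.range k, C (p.coeff i / (i + 1)) * X ^ (i + 1), ?_, ?_⟩
    · refine (degree_sum_le _ _).trans_lt ((Finset.sup_lt_iff (WithBot.bot_lt_coe _)).2 ?_)
      intro i hi
      refine (degree_C_mul_X_pow_le _ _).trans_lt ?_
      exact_mod_cast Nat.succ_lt_succ (Finset.mem_range.1 hi)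
    · ext n
      have hn : (n : ℝ) + 1 ≠ 0 := by positivity
      simp only [derivative_sum, derivative_C_mul_X_pow, finsetSum_coeff, coeff_C_mul_X_pow,
        Nat.add_sub_cancel, Finset.sum_ite_eq, Finset.mem_range]
      split_ifs with h
      · push_cast; exact div_mul_cancel₀ _ hn
      · exact (coeff_eq_zero_of_degree_lt (hp.trans_le (by exact_mod_cast not_lt.1 h))).symm
  obtain ⟨P, h1, h2⟩ := key
  refine ⟨P + C (v - P.eval t₀), ?_, by simp [h2], by simp⟩
  refine (degree_add_le _ _).trans_lt (max_lt h1 (degree_C_le.trans_lt ?_))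
  exact_mod_cast Nat.succ_pos k

theorem altDiff_eq_mixedDiff (k : ℕ) (g : ℝ → ℝ) (y a : ℝ) :
    altDiff k g y a = (-1) ^ k * mixedDiff k (fun _ => a) g y := by
  rw [altDiff_eq_fwdDiff, mixedDiff_const]

/-- On a short interval, a continuous function with bounded mixed differences is close to a
polynomial. -/
theorem exists_polynomial_of_mixedDiff (k : ℕ) : ∀ l : ℝ, 0 < l → ∃ δ : ℝ, 0 < δ ∧ δ ≤ l ∧
    ∃ K : ℝ, 0 ≤ K ∧ ∀ g : ℝ → ℝ, Continuous g → ∀ c M : ℝ, 0 ≤ M →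
      (∀ h : ℕ → ℝ, (∀ j, 0 ≤ h j) → ∀ x, c ≤ x → x + ∑ j ∈ Finset.range k, h j ≤ c + l →
        |mixedDiff k h g x| ≤ M) →
      ∃ p : ℝ[X], p.degree < k ∧ ∀ x ∈ Set.Icc c (c + δ), |g x - p.eval x| ≤ K * M := by
  induction k with
  | zero =>
    intro l hl
    refine ⟨l, hl, le_rfl, 1, zero_le_one, fun g _ c M _ H => ⟨0, by simp, fun x hx => ?_⟩⟩
    simpa [mixedDiff] using H 0 (fun _ => le_rfl) x hx.1 (by simpa using hx.2)
  | succ k ih =>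
    intro l hl
    obtain ⟨δ, hδ, hδl, K, hK, ih⟩ := ih (l / 2) (by linarith)
    have hn : (0 : ℝ) < (k + 1 : ℕ) := by positivity
    -- The longest shift `(k + 1) * H` uses half of `l`; the other half is left for the induction
    -- hypothesis.
    set H : ℝ := l / (2 * (k + 1 : ℕ)) with hH
    have hH0 : 0 < H := by positivity
    have hnH : (k + 1 : ℕ) * H = l / 2 := by rw [hH]; field_simp
    let e : ℕ → ℝ := fun j => (-1) ^ j * ((k + 1).choose (j + 1) : ℝ)
    let b : ℕ → ℝ := fun j => e j / ((j + 1) * H)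
    let B : ℝ := ∑ j ∈ Finset.range (k + 1), |b j|
    have hB : 0 ≤ B := Finset.sum_nonneg fun _ _ => abs_nonneg _
    refine ⟨δ, hδ, by linarith, 1 + K * B * δ, by positivity, fun g hg c M hM hmix => ?_⟩
    have hpure : ∀ x h : ℝ, c ≤ x → 0 ≤ h → x + (k + 1 : ℕ) * h ≤ c + l →
        |g x - ∑ j ∈ Finset.range (k + 1), e j * g (x + (j + 1) * h)| ≤ M := by
      intro x h hx hh hxh
      have h1 := hmix (fun _ => h) (fun _ => hh) x hx (by simpa using hxh)
      have h2 := altDiff_eq_mixedDiff (k + 1) g x h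
      have h3 : altDiff (k + 1) g x h =
          g x - ∑ j ∈ Finset.range (k + 1), e j * g (x + (j + 1) * h) := by
        rw [altDiff, Finset.sum_range_succ', sub_eq_neg_add, ← Finset.sum_neg_distrib]
        congr 1
        · refine Finset.sum_congr rfl fun j _ => ?_
          simp only [e, pow_succ]; push_cast; ring
        · simp
      rw [← h3, h2, abs_mul, abs_pow]
      simpa using h1
    let Φ : ℝ → ℝ := fun x => ∫ t in (0 : ℝ)..x, g t
    have hΦ : ∀ x, HasDerivAt Φ (g x) x := fun x => hg.integral_hasStrictDerivAt 0 x |>.hasDerivAt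
    -- `A x` is the mean over `0 ≤ h ≤ H` of `∑ e j * g (x + (j + 1) * h)`, and `D` is its
    -- derivative.
    let A : ℝ → ℝ := fun x => ∑ j ∈ Finset.range (k + 1), b j * (Φ (x + (j + 1) * H) - Φ x)
    let D : ℝ → ℝ := fun x => ∑ j ∈ Finset.range (k + 1), b j * (g (x + (j + 1) * H) - g x)
    have hA : ∀ x, HasDerivAt A (D x) x := fun x => HasDerivAt.fun_sum fun j _ =>
      (((hΦ _).comp_add_const x _).sub (hΦ x)).const_mul _
    have hD : Continuous D := by fun_prop
    -- Each summand of `D` is a first difference of `g`, so its mixed difference of order `k` is one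
    -- of `g` of order `k + 1`, with the extra step `(j + 1) * H`.
    have hDmix : ∀ h : ℕ → ℝ, (∀ j, 0 ≤ h j) → ∀ x, c ≤ x →
        x + ∑ j ∈ Finset.range k, h j ≤ c + l / 2 → |mixedDiff k h D x| ≤ B * M := by
      intro h hh x hx hxh
      rw [mixedDiff_sum _ _ _ _ (fun (j : ℕ) y => g (y + (j + 1) * H) - g y), Finset.sum_mul]
      refine (Finset.abs_sum_le_sum_abs _ _).trans (Finset.sum_le_sum fun j hj => ?_)
      rw [abs_mul]
      refine mul_le_mul_of_nonneg_left ?_ (abs_nonneg _)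
      have hj1 : ((j : ℝ) + 1) ≤ (k + 1 : ℕ) := by
        exact_mod_cast Nat.succ_le_of_lt (Finset.mem_range.1 hj)
      have hv : ((j : ℝ) + 1) * H ≤ l / 2 := by
        rw [← hnH]; exact mul_le_mul_of_nonneg_right hj1 hH0.le
      have hv0 : 0 ≤ ((j : ℝ) + 1) * H := by positivity
      set h' := Function.update h k ((j + 1) * H) with hh'
      have e0 : ∀ i < k, h' i = h i := fun i hi => Function.update_of_ne hi.ne _ _
      have e1 : mixedDiff k h (fun y => g (y + (j + 1) * H) - g y) x =
          mixedDiff (k + 1) h' g x := by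
        rw [mixedDiff_sub, mixedDiff_shift, mixedDiff, mixedDiff_congr e0, mixedDiff_congr e0,
          hh', Function.update_self]
      rw [e1]
      refine hmix h' (fun i => ?_) x hx ?_
      · rcases eq_or_ne i k with rfl | hi
        · simpa [hh'] using hv0
        · simpa [hh', hi] using hh i
      · rw [Finset.sum_range_succ, Finset.sum_congr rfl fun i hi => e0 i (Finset.mem_range.1 hi),
          hh', Function.update_self]
        linarith
    obtain ⟨q, hq, hDq⟩ := ih D hD c (B * M) (by positivity) hDmix
    obtain ⟨P, hP, hPq, hPc⟩ := exists_antiderivative hq c (A c)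
    refine ⟨P, hP, fun x hx => ?_⟩
    have hAP : |A x - P.eval x| ≤ K * (B * M) * δ := by
      have := norm_image_sub_le_of_norm_deriv_le_segment' (f := fun t => A t - P.eval t)
        (f' := fun t => D t - q.eval t) (C := K * (B * M)) (a := c) (b := c + δ)
        (fun t _ => ((hA t).sub (hPq ▸ P.hasDerivAt t)).hasDerivWithinAt)
        (fun t ht => hDq t ⟨ht.1, ht.2.le⟩) x hx
      rw [hPc, sub_self, sub_zero, Real.norm_eq_abs] at this
      refine this.trans (mul_le_mul_of_nonneg_left ?_ (by positivity))
      linarith [hx.2]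
    have hgA : |g x - A x| ≤ M := by
      -- Mean value inequality in `h`: the derivative is the pure difference bounded in `hpure`, the
      -- increment over `[0, H]` is `H * (g x - A x)`.
      have := norm_image_sub_le_of_norm_deriv_le_segment'
        (f := fun h => h * g x - ∑ j ∈ Finset.range (k + 1), e j / (j + 1) * Φ (x + (j + 1) * h))
        (f' := fun h => g x - ∑ j ∈ Finset.range (k + 1), e j * g (x + (j + 1) * h))
        (C := M) (a := 0) (b := H) (fun h _ => ?_) (fun h hh => hpure x h hx.1 hh.1 ?_) H
        ⟨hH0.le, le_rfl⟩
      · have e2 : H * g x - ∑ j ∈ Finset.range (k + 1), e j / (j + 1) * Φ (x + (j + 1) * H) -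
            (0 * g x - ∑ j ∈ Finset.range (k + 1), e j / (j + 1) * Φ (x + (j + 1) * 0)) =
            H * (g x - A x) := by
          have : H * A x = ∑ j ∈ Finset.range (k + 1),
              (e j / (j + 1) * Φ (x + (j + 1) * H) - e j / (j + 1) * Φ (x + (j + 1) * 0)) := by
            rw [Finset.mul_sum]
            refine Finset.sum_congr rfl fun j _ => ?_
            have : (j : ℝ) + 1 ≠ 0 := by positivity
            simp only [b]
            rw [mul_zero, add_zero]
            field_simp
          rw [mul_sub, this, Finset.sum_sub_distrib]
          ring
        rw [e2, norm_mul, Real.norm_of_nonneg hH0.le, Real.norm_eq_abs, sub_zero, mul_comm] at this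
        exact le_of_mul_le_mul_right this hH0
      · refine HasDerivAt.hasDerivWithinAt ?_
        refine ((hasDerivAt_mul_const (g x)).sub (HasDerivAt.fun_sum fun j _ => ?_))
        have h1 : HasDerivAt (fun h : ℝ => x + (j + 1) * h) ((j : ℝ) + 1) h := by
          simpa using ((hasDerivAt_id h).const_mul ((j : ℝ) + 1)).const_add x
        have h2 := ((hΦ (x + (j + 1) * h)).comp h h1).const_mul (e j / (j + 1))
        have : (j : ℝ) + 1 ≠ 0 := by positivity
        refine h2.congr_deriv ?_
        field_simp
      · have : (k + 1 : ℕ) * h ≤ (k + 1 : ℕ) * H := mul_le_mul_of_nonneg_left hh.2.le hn.le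
        linarith [hx.2]
    calc |g x - P.eval x| ≤ |g x - A x| + |A x - P.eval x| := abs_sub_le _ _ _
      _ ≤ M + K * (B * M) * δ := add_le_add hgA hAP
      _ = (1 + K * B * δ) * M := by ring

theorem sum_choose_succ_le (k : ℕ) :
    ∑ j ∈ Finset.range k, (k.choose (j + 1) : ℝ) ≤ 2 ^ k := by
  have h := Nat.sum_range_choose k
  rw [Finset.sum_range_succ'] at h
  exact_mod_cast (Nat.le_add_right _ _).trans h.le

/-- Solving a finite difference for the value at its end node. -/
theorem abs_le_of_altDiff {k : ℕ} {F : ℝ → ℝ} {x a M M' : ℝ} (hM' : 0 ≤ M')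
    (h : |altDiff k F x a| ≤ M) (hF : ∀ j < k, |F (x + (j + 1) * a)| ≤ M') :
    |F x| ≤ M + 2 ^ k * M' := by
  have e : F x = altDiff k F x a -
      ∑ j ∈ Finset.range k, (-1 : ℝ) ^ (j + 1) * (k.choose (j + 1) : ℝ) * F (x + (j + 1) * a) := by
    rw [altDiff, Finset.sum_range_succ']
    simp
  have h2 : |∑ j ∈ Finset.range k,
      (-1 : ℝ) ^ (j + 1) * (k.choose (j + 1) : ℝ) * F (x + (j + 1) * a)| ≤ 2 ^ k * M' := by
    refine (Finset.abs_sum_le_sum_abs _ _).trans ?_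
    refine le_trans (Finset.sum_le_sum (g := fun j : ℕ => (k.choose (j + 1) : ℝ) * M')
      fun j hj => ?_) ?_
    · rw [abs_mul, abs_mul, abs_pow, abs_neg, abs_one, one_pow, one_mul, Nat.abs_cast]
      exact mul_le_mul_of_nonneg_left (hF j (Finset.mem_range.1 hj)) (Nat.cast_nonneg _)
    · rw [← Finset.sum_mul]
      exact mul_le_mul_of_nonneg_right (sum_choose_succ_le k) hM'
  rw [e]
  exact (abs_sub _ _).trans (add_le_add h h2)

/-- Bounds propagate from a short interval to a larger one through finite differences. -/
theorem exists_bound_extend {k : ℕ} (hk : 1 ≤ k) {δ K : ℝ} (hδ : 0 < δ) (hK : 0 ≤ K) (n : ℕ) :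
    ∃ K' : ℝ, 0 ≤ K' ∧ ∀ (F : ℝ → ℝ) (M α : ℝ), 0 ≤ M → 0 ≤ α → α + δ ≤ 1 →
      (∀ y a : ℝ, y ∈ Set.Icc (0 : ℝ) 1 → y + k * a ∈ Set.Icc (0 : ℝ) 1 → |altDiff k F y a| ≤ M) →
      (∀ x ∈ Set.Icc α (α + δ), |F x| ≤ K * M) →
      ∀ x ∈ Set.Icc (0 : ℝ) 1, α - n * (δ / k) ≤ x → x ≤ α + δ + n * (δ / k) →
        |F x| ≤ K' * M := by
  have hk0 : (0 : ℝ) < k := by exact_mod_cast hk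
  induction n with
  | zero =>
    exact ⟨K, hK, fun F M α _ _ _ _ H x _ h1 h2 => H x ⟨by simpa using h1, by simpa using h2⟩⟩
  | succ n ih =>
    obtain ⟨K', hK', ih⟩ := ih
    refine ⟨K' + (1 + 2 ^ k * K'), by positivity, fun F M α hM hα hα1 hF H x hx h1 h2 => ?_⟩
    have ih := ih F M α hM hα hα1 hF H
    set η := δ / k with hη
    have hη0 : 0 < η := by positivity
    have hkη : k * η = δ := by rw [hη]; field_simp
    have hn0 : 0 ≤ n * η := by positivity
    push_cast at h1 h2
    have hj : ∀ j < k, η ≤ ((j : ℝ) + 1) * η ∧ ((j : ℝ) + 1) * η ≤ δ := fun j hj => by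
      have : ((j : ℝ) + 1) ≤ k := by exact_mod_cast hj
      constructor
      · nlinarith [(Nat.cast_nonneg j : (0 : ℝ) ≤ j)]
      · rw [← hkη]; exact mul_le_mul_of_nonneg_right this hη0.le
    have hstep : |F x| ≤ K' * M → |F x| ≤ (K' + (1 + 2 ^ k * K')) * M := fun h => by
      have : 0 ≤ (1 + 2 ^ k * K') * M := by positivity
      linarith
    have hstep' : |F x| ≤ M + 2 ^ k * (K' * M) → |F x| ≤ (K' + (1 + 2 ^ k * K')) * M := fun h => by
      have : 0 ≤ K' * M := by positivity
      linarith
    by_cases hl : x < α - n * η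
    -- With step `η = δ / k` the other `k` nodes lie in `[x + η, x + δ]`, inside the range already
    -- reached.
    · refine hstep' (abs_le_of_altDiff (a := η) (by positivity) (hF x η hx ?_) fun j hjk => ?_)
      · rw [hkη]; exact ⟨by linarith [hx.1], by linarith⟩
      · obtain ⟨h3, h4⟩ := hj j hjk
        exact ih _ ⟨by linarith [hx.1], by linarith⟩ (by linarith) (by linarith)
    by_cases hr : α + δ + n * η < x
    · refine hstep' (abs_le_of_altDiff (a := -η) (by positivity) (hF x (-η) hx ?_) fun j hjk => ?_)
      · rw [mul_neg, hkη]; exact ⟨by linarith, by linarith [hx.2]⟩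
      · obtain ⟨h3, h4⟩ := hj j hjk
        rw [mul_neg]
        exact ih _ ⟨by linarith, by linarith [hx.2]⟩ (by linarith) (by linarith)
    exact hstep (ih x hx (not_lt.1 hl) (not_lt.1 hr))

/-- Whitney's theorem on the unit interval. -/
theorem exists_polynomial_of_altDiff {k : ℕ} (hk : 1 ≤ k) :
    ∃ K : ℝ, 0 ≤ K ∧ ∀ g : ℝ → ℝ, Continuous g → ∀ M : ℝ, 0 ≤ M →
      (∀ y a : ℝ, y ∈ Set.Icc (0 : ℝ) 1 → y + k * a ∈ Set.Icc (0 : ℝ) 1 → |altDiff k g y a| ≤ M) →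
      ∃ p : ℝ[X], p.degree < k ∧ ∀ x ∈ Set.Icc (0 : ℝ) 1, |g x - p.eval x| ≤ K * M := by
  have hk0 : (0 : ℝ) < k := by exact_mod_cast hk
  -- On `[1 - l, 1]` the steps add up to at most `l`, and Kemperman's lemma needs room `k * l` to
  -- the left: `1 - l - k * l = 0`.
  set l : ℝ := 1 / (k + 1) with hl
  have hl0 : 0 < l := by positivity
  have hkl : (k + 1) * l = 1 := by rw [hl]; field_simp
  have hkl0 : 0 < k * l := by positivity
  obtain ⟨δ, hδ, hδl, K, hK, H⟩ := exists_polynomial_of_mixedDiff k l hl0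
  -- Enough extensions by `δ / k` to sweep all of `[0, 1]`.
  obtain ⟨n, hn⟩ := exists_nat_ge (1 / (δ / k))
  have hnδ : 1 ≤ n * (δ / k) := (div_le_iff₀ (by positivity)).1 hn
  obtain ⟨K', hK', H'⟩ := exists_bound_extend hk hδ (K := K * 2 ^ k) (by positivity) n
  refine ⟨K', hK', fun g hg M hM hpure => ?_⟩
  obtain ⟨p, hp, hgp⟩ := H g hg (1 - l) (2 ^ k * M) (by positivity) fun h hh x hx hxh => by
    refine abs_mixedDiff_le_of_altDiff hpure h hh x (by linarith) ?_
    have : (k : ℝ) * ∑ j ∈ Finset.range k, h j ≤ k * l :=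
      mul_le_mul_of_nonneg_left (by linarith) hk0.le
    linarith
  refine ⟨p, hp, fun x hx => H' (fun t => g t - p.eval t) M (1 - l) hM (by linarith) (by linarith)
    (fun y a hy hya => ?_) (fun x hx => ?_) x hx (by linarith [hx.1]) (by linarith [hx.2])⟩
  · rw [altDiff_sub, altDiff_polynomial hp, sub_zero]
    exact hpure y a hy hya
  · rw [mul_assoc]; exact hgp x hx

/-! ### From alternating sums to the modulus of smoothness. -/

theorem altDiff_reflect (k : ℕ) (g : ℝ → ℝ) (y a : ℝ) :
    altDiff k g y a = (-1) ^ k * altDiff k g (y + k * a) (-a) := by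
  rw [altDiff, altDiff, ← Finset.sum_range_reflect, Finset.mul_sum]
  refine Finset.sum_congr rfl fun i hi => ?_
  obtain ⟨d, rfl⟩ := Nat.exists_eq_add_of_le (Nat.lt_succ_iff.1 (Finset.mem_range.1 hi))
  have h1 : (-1 : ℝ) ^ (i + d) * (-1) ^ i = (-1) ^ d := by
    rw [pow_add, mul_right_comm, ← mul_pow]; simp
  have h2 : i + d + 1 - 1 - i = d := by omega
  rw [h2, ← mul_assoc, ← mul_assoc, h1, Nat.choose_symm_add]
  push_cast
  congr 2
  ring

theorem mem_Icc_of_endpoints {a b y z : ℝ} {k i : ℕ} (hi : i ≤ k) (hy : y ∈ Set.Icc a b)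
    (hz : y + k * z ∈ Set.Icc a b) : y + i * z ∈ Set.Icc a b := by
  have h1 : (i : ℝ) ≤ k := by exact_mod_cast hi
  have h0 : (0 : ℝ) ≤ i := i.cast_nonneg
  obtain ⟨h2, h3⟩ := hy
  obtain ⟨h4, h5⟩ := hz
  rcases le_total 0 z with h | h
  · exact ⟨by nlinarith, by nlinarith⟩
  · exact ⟨by nlinarith, by nlinarith⟩

theorem centralDiff_eq_altDiff {k : ℕ} {a b u y : ℝ} (g : ℝ → ℝ)
    (h : y - (k : ℝ) / 2 * u ∈ Set.Icc a b ∧ y + (k : ℝ) / 2 * u ∈ Set.Icc a b) :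
    centralDiff k g a b u y = altDiff k g (y + (k : ℝ) / 2 * u) (-u) := by
  rw [centralDiff, if_pos h, altDiff]
  refine Finset.sum_congr rfl fun i _ => ?_
  congr 2
  ring

theorem abs_centralDiff_le {k : ℕ} {g : ℝ → ℝ} {a b G : ℝ} (hG0 : 0 ≤ G)
    (hG : ∀ t ∈ Set.Icc a b, |g t| ≤ G) (u y : ℝ) : |centralDiff k g a b u y| ≤ 2 ^ k * G := by
  by_cases h : y - (k : ℝ) / 2 * u ∈ Set.Icc a b ∧ y + (k : ℝ) / 2 * u ∈ Set.Icc a b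
  · rw [centralDiff_eq_altDiff g h, altDiff]
    refine (Finset.abs_sum_le_sum_abs _ _).trans ?_
    refine le_trans (Finset.sum_le_sum (g := fun j : ℕ => (k.choose j : ℝ) * G)
      fun j hj => ?_) ?_
    · rw [abs_mul, abs_mul, abs_pow, abs_neg, abs_one, one_pow, one_mul, Nat.abs_cast]
      refine mul_le_mul_of_nonneg_left (hG _ (mem_Icc_of_endpoints (k := k)
        (Nat.lt_succ_iff.1 (Finset.mem_range.1 hj)) h.2 ?_)) (Nat.cast_nonneg _)
      convert h.1 using 1; ring
    · rw [← Finset.sum_mul]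
      refine mul_le_mul_of_nonneg_right (le_of_eq ?_) hG0
      exact_mod_cast Nat.sum_range_choose k
  · rw [centralDiff, if_neg h, abs_zero]; positivity

theorem modulus_nonneg (k : ℕ) (g : ℝ → ℝ) (t a b : ℝ) : 0 ≤ modulus k g t a b :=
  Real.sSup_nonneg (by rintro _ ⟨u, y, -, -, -, rfl⟩; exact abs_nonneg _)

theorem abs_altDiff_le_modulus {k : ℕ} (hk : 1 ≤ k) {g : ℝ → ℝ} {a b : ℝ}
    (hg : ContinuousOn g (Set.Icc a b)) {y z : ℝ} (hy : y ∈ Set.Icc a b)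
    (hz : y + k * z ∈ Set.Icc a b) : |altDiff k g y z| ≤ modulus k g (b - a) a b := by
  obtain ⟨G, hG⟩ := isCompact_Icc.exists_bound_of_continuousOn hg
  have hk1 : (1 : ℝ) ≤ k := by exact_mod_cast hk
  -- The nodes of `centralDiff` run from right to left, hence the negative step; positive steps
  -- reduce to it by `altDiff_reflect`.
  have hneg : ∀ y u : ℝ, 0 < u → y ∈ Set.Icc a b → y + k * (-u) ∈ Set.Icc a b →
      |altDiff k g y (-u)| ≤ modulus k g (b - a) a b := by
    intro y u hu hy hz
    refine le_csSup ⟨2 ^ k * G, ?_⟩ ⟨u, y - k / 2 * u, hu, ?_, ?_, ?_⟩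
    · rintro _ ⟨u, y', -, -, -, rfl⟩
      exact abs_centralDiff_le ((norm_nonneg _).trans (hG y hy)) hG u y'
    · nlinarith [hy.2, hz.1]
    · constructor <;> nlinarith [hy.1, hy.2, hz.1, hz.2]
    · rw [centralDiff_eq_altDiff, sub_add_cancel]
      refine ⟨?_, by simpa using hy⟩
      convert hz using 1; ring
  rcases lt_trichotomy z 0 with h | rfl | h
  · simpa using hneg y (-z) (neg_pos.2 h) hy (by simpa using hz)
  -- The modulus excludes step zero; there the sum is that of a constant, which vanishes since `k ≥
  -- 1`.
  · have h0 : altDiff k (fun t => (C (g y)).eval t) y 0 = 0 :=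
      altDiff_polynomial (degree_C_le.trans_lt (by exact_mod_cast hk)) y 0
    have : altDiff k g y 0 = 0 := by simpa [altDiff] using h0
    rw [this, abs_zero]
    exact modulus_nonneg _ _ _ _ _
  · rw [altDiff_reflect, abs_mul, abs_pow, abs_neg, abs_one, one_pow, one_mul]
    exact hneg _ z h hz (by simpa using hy)

/-- Whitney's theorem: a continuous function on `[a, b]` is approximated by polynomials of degree
less than `k` to within a constant multiple of its `k`-th modulus of smoothness. -/
theorem exists_polynomial_abs_sub_le_modulus {k : ℕ} (hk : 1 ≤ k) :
    ∃ K : ℝ, 0 ≤ K ∧ ∀ (g : ℝ → ℝ) (a b : ℝ), a < b → ContinuousOn g (Set.Icc a b) →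
      ∃ p : ℝ[X], p.degree < k ∧
        ∀ x ∈ Set.Icc a b, |g x - p.eval x| ≤ K * modulus k g (b - a) a b := by
  obtain ⟨K, hK, H⟩ := exists_polynomial_of_altDiff hk
  refine ⟨K, hK, fun g a b hab hg => ?_⟩
  have hba : 0 < b - a := sub_pos.2 hab
  have hmem : ∀ {s : ℝ}, s ∈ Set.Icc (0 : ℝ) 1 → a + (b - a) * s ∈ Set.Icc a b := fun {s} hs =>
    ⟨by nlinarith [hs.1], by nlinarith [hs.2]⟩
  -- The theorem on `[0, 1]` asks for continuity on the whole line, so `g` is extended by its end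
  -- values.
  set G : ℝ → ℝ := Set.IccExtend hab.le ((Set.Icc a b).domRestrict g) with hGdef
  have hG : Continuous G := hg.domRestrict.Icc_extend'
  have hGg : ∀ x ∈ Set.Icc a b, G x = g x := fun x hx => Set.IccExtend_of_mem _ _ hx
  obtain ⟨p, hp, hGp⟩ := H (fun s => G (a + (b - a) * s)) (by fun_prop) _
    (modulus_nonneg k g (b - a) a b) fun y z hy hz => by
      have e : altDiff k (fun s => G (a + (b - a) * s)) y z =
          altDiff k g (a + (b - a) * y) ((b - a) * z) := by
        refine Finset.sum_congr rfl fun i hi => ?_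
        beta_reduce
        rw [hGg _ (hmem (mem_Icc_of_endpoints (Nat.lt_succ_iff.1 (Finset.mem_range.1 hi)) hy hz))]
        congr 2; ring
      rw [e]
      refine abs_altDiff_le_modulus hk hg (hmem hy) ?_
      convert hmem hz using 1; ring
  refine ⟨p.comp (C (1 / (b - a)) * (X - C a)), ?_, fun x hx => ?_⟩
  · rcases eq_or_ne p 0 with rfl | h0
    · simp
    have h1 : (p.comp (C (1 / (b - a)) * (X - C a))).natDegree ≤ p.natDegree := by
      refine natDegree_comp_le.trans ?_
      calc _ ≤ p.natDegree * 1 := Nat.mul_le_mul_left _ (by compute_degree)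
        _ = p.natDegree := mul_one _
    exact lt_of_le_of_lt (degree_le_of_natDegree_le h1) (by rwa [← degree_eq_natDegree h0])
  · have hs : (x - a) / (b - a) ∈ Set.Icc (0 : ℝ) 1 :=
      ⟨div_nonneg (by linarith [hx.1]) hba.le, (div_le_one hba).2 (by linarith [hx.2])⟩
    have e : a + (b - a) * ((x - a) / (b - a)) = x := by field_simp; ring
    have := hGp _ hs
    simp only [e, hGg x hx] at this
    simpa [div_eq_inv_mul] using this

/-! ### Interpolation of polynomials by division with remainder. -/

/-- The monic polynomial with roots `x i, …, x (i + n - 1)`. -/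
noncomputable def nodePoly (x : ℕ → ℝ) (i n : ℕ) : ℝ[X] :=
  ∏ l ∈ Finset.range n, (X - C (x (i + l)))

/-- The leading coefficient of the Hermite interpolant of the polynomial `F` at
`x i, …, x (i + n)`. -/
noncomputable def newtonCoeff (F : ℝ[X]) (x : ℕ → ℝ) (n i : ℕ) : ℝ :=
  (F %ₘ nodePoly x i (n + 1)).coeff n

theorem nodePoly_monic (x : ℕ → ℝ) (i n : ℕ) : (nodePoly x i n).Monic :=
  monic_prod_of_monic _ _ fun _ _ => monic_X_sub_C _

theorem nodePoly_degree (x : ℕ → ℝ) (i n : ℕ) : (nodePoly x i n).degree = n := by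
  rw [degree_eq_natDegree (nodePoly_monic x i n).ne_zero, nodePoly,
    natDegree_prod_of_monic _ _ fun _ _ => monic_X_sub_C _]
  simp

theorem nodePoly_succ (x : ℕ → ℝ) (i n : ℕ) :
    nodePoly x i (n + 1) = nodePoly x i n * (X - C (x (i + n))) :=
  Finset.prod_range_succ _ _

theorem nodePoly_succ' (x : ℕ → ℝ) (i n : ℕ) :
    nodePoly x i (n + 1) = (X - C (x i)) * nodePoly x (i + 1) n := by
  rw [nodePoly, Finset.prod_range_succ', mul_comm, nodePoly]
  simp only [add_zero, add_assoc, add_comm 1]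

theorem degree_modByMonic_nodePoly_lt (F : ℝ[X]) (x : ℕ → ℝ) (i n : ℕ) :
    (F %ₘ nodePoly x i n).degree < n :=
  (degree_modByMonic_lt F (nodePoly_monic x i n)).trans_eq (nodePoly_degree x i n)

theorem nodePoly_dvd_sub (F : ℝ[X]) (x : ℕ → ℝ) (i n : ℕ) :
    nodePoly x i n ∣ F - F %ₘ nodePoly x i n :=
  (dvd_sub_comm).1 (dvd_modByMonic_sub F _)

theorem modByMonic_nodePoly_eq {F R : ℝ[X]} {x : ℕ → ℝ} {i n : ℕ} (hR : R.degree < n)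
    (h : nodePoly x i n ∣ F - R) : F %ₘ nodePoly x i n = R := by
  obtain ⟨q, hq⟩ := h
  exact (div_modByMonic_unique q R (nodePoly_monic x i n)
    ⟨by rw [← hq]; ring, hR.trans_eq (nodePoly_degree x i n).symm⟩).2

/-- Subtracting the top coefficient times `nodePoly x i n` lowers the degree below `n` without
changing the class modulo `nodePoly x i n`. -/
theorem modByMonic_nodePoly_succ (F : ℝ[X]) (x : ℕ → ℝ) (i n : ℕ) :
    F %ₘ nodePoly x i (n + 1) =
      F %ₘ nodePoly x i n + C (newtonCoeff F x n i) * nodePoly x i n := by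
  rw [← sub_eq_iff_eq_add]
  refine (modByMonic_nodePoly_eq ?_ ?_).symm
  · rw [degree_lt_iff_coeff_zero]
    intro j hj
    rw [coeff_sub, coeff_C_mul]
    rcases hj.eq_or_lt with rfl | hj
    · have : (nodePoly x i n).coeff n = 1 := by
        have := nodePoly_monic x i n
        rwa [Monic, leadingCoeff, natDegree_eq_of_degree_eq_some (nodePoly_degree x i n)] at this
      rw [this, newtonCoeff, mul_one, sub_self]
    · have h1 := (degree_lt_iff_coeff_zero _ _).1 (degree_modByMonic_nodePoly_lt F x i (n + 1)) j hj
      have h2 : (nodePoly x i n).coeff j = 0 :=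
        coeff_eq_zero_of_degree_lt (by rw [nodePoly_degree]; exact_mod_cast hj)
      rw [h1, h2, mul_zero, sub_zero]
  · have h1 : nodePoly x i n ∣ F - F %ₘ nodePoly x i (n + 1) :=
      (Dvd.intro _ (nodePoly_succ x i n).symm).trans (nodePoly_dvd_sub F x i (n + 1))
    rw [sub_sub_eq_add_sub, add_sub_right_comm]
    exact dvd_add h1 (dvd_mul_left _ _)

/-- Newton's form of the interpolant. -/
theorem modByMonic_nodePoly_eq_sum (F : ℝ[X]) (x : ℕ → ℝ) (i n : ℕ) :
    F %ₘ nodePoly x i n = ∑ j ∈ Finset.range n, C (newtonCoeff F x j i) * nodePoly x i j := by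
  induction n with
  | zero => simp [nodePoly]
  | succ n ih => rw [modByMonic_nodePoly_succ, ih, Finset.sum_range_succ]

theorem newtonCoeff_zero (F : ℝ[X]) (x : ℕ → ℝ) (i : ℕ) : newtonCoeff F x 0 i = F.eval (x i) := by
  simp [newtonCoeff, nodePoly, modByMonic_X_sub_C_eq_C_eval]

/-- The Aitken–Neville formula: the interpolant at all knots is a linear combination of those
omitting the last or the first knot. Top coefficients are then compared. -/
theorem newtonCoeff_succ_of_ne (F : ℝ[X]) {x : ℕ → ℝ} {n i : ℕ} (h : x i ≠ x (i + (n + 1))) :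
    newtonCoeff F x (n + 1) i =
      (newtonCoeff F x n (i + 1) - newtonCoeff F x n i) / (x (i + (n + 1)) - x i) := by
  have hne : x (i + (n + 1)) - x i ≠ 0 := sub_ne_zero.2 h.symm
  set P₀ := F %ₘ nodePoly x i (n + 1) with hP₀
  set P₁ := F %ₘ nodePoly x (i + 1) (n + 1) with hP₁
  have d₀ : ∀ j, n + 1 ≤ j → P₀.coeff j = 0 :=
    (degree_lt_iff_coeff_zero _ _).1 (degree_modByMonic_nodePoly_lt F x i (n + 1))
  have d₁ : ∀ j, n + 1 ≤ j → P₁.coeff j = 0 :=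
    (degree_lt_iff_coeff_zero _ _).1 (degree_modByMonic_nodePoly_lt F x (i + 1) (n + 1))
  have e : F %ₘ nodePoly x i (n + 1 + 1) = C (x (i + (n + 1)) - x i)⁻¹ *
      ((X - C (x i)) * P₁ - (X - C (x (i + (n + 1)))) * P₀) := by
    refine modByMonic_nodePoly_eq ?_ ?_
    · rw [degree_lt_iff_coeff_zero]
      intro j hj
      obtain ⟨j, rfl⟩ := Nat.exists_eq_add_of_le' (show 1 ≤ j by omega)
      simp only [coeff_C_mul, coeff_sub, coeff_X_sub_C_mul]
      rw [d₀ j (by omega), d₁ j (by omega), d₀ (j + 1) (by omega), d₁ (j + 1) (by omega)]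
      simp
    · have e1 : F - C (x (i + (n + 1)) - x i)⁻¹ *
          ((X - C (x i)) * P₁ - (X - C (x (i + (n + 1)))) * P₀) =
          C (x (i + (n + 1)) - x i)⁻¹ *
          ((X - C (x i)) * (F - P₁) - (X - C (x (i + (n + 1)))) * (F - P₀)) := by
        have : F = C (x (i + (n + 1)) - x i)⁻¹ * (C (x (i + (n + 1))) - C (x i)) * F := by
          rw [← C_sub, ← C_mul, inv_mul_cancel₀ hne, C_1, one_mul]
        linear_combination this
      rw [e1]
      refine dvd_mul_of_dvd_right (dvd_sub ?_ ?_) _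
      · rw [nodePoly_succ']
        exact mul_dvd_mul_left _ (nodePoly_dvd_sub F x (i + 1) (n + 1))
      · rw [nodePoly_succ, mul_comm]
        exact mul_dvd_mul_left _ (nodePoly_dvd_sub F x i (n + 1))
  rw [newtonCoeff, e]
  simp only [coeff_C_mul, coeff_sub, coeff_X_sub_C_mul]
  rw [d₀ (n + 1) le_rfl, d₁ (n + 1) le_rfl, newtonCoeff, newtonCoeff]
  field_simp
  ring

theorem eval_iterate_derivative_eq_of_dvd {F R : ℝ[X]} {t : ℝ} {k : ℕ}
    (h : (X - C t) ^ (k + 1) ∣ F - R) :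
    (derivative^[k] F).eval t = (derivative^[k] R).eval t := by
  have h1 := pow_sub_dvd_iterate_derivative_of_pow_dvd k h
  rw [Nat.add_sub_cancel_left, pow_one, dvd_iff_isRoot, iterate_derivative_sub] at h1
  simpa [IsRoot, sub_eq_zero] using h1

theorem iterate_derivative_of_degree_lt_succ {R : ℝ[X]} {n : ℕ}
    (hR : R.degree < ((n + 1 : ℕ) : WithBot ℕ)) :
    derivative^[n] R = C (n.factorial * R.coeff n) := by
  ext j
  rw [coeff_iterate_derivative, coeff_C]
  rcases eq_or_ne j 0 with rfl | hj
  · simp [Nat.descFactorial_self]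
  · rw [if_neg hj, (degree_lt_iff_coeff_zero _ _).1 hR _ (by omega), smul_zero]

theorem newtonCoeff_of_eq (F : ℝ[X]) {x : ℕ → ℝ} {n i : ℕ} (h : ∀ l ≤ n, x (i + l) = x i) :
    newtonCoeff F x n i = (derivative^[n] F).eval (x i) / n.factorial := by
  have hW : nodePoly x i (n + 1) = (X - C (x i)) ^ (n + 1) := by
    rw [nodePoly, Finset.prod_congr rfl fun l hl => by
      rw [h l (Nat.lt_succ_iff.1 (Finset.mem_range.1 hl))]]
    simp
  have h1 := nodePoly_dvd_sub F x i (n + 1)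
  rw [hW] at h1
  rw [eval_iterate_derivative_eq_of_dvd h1, ← hW,
    iterate_derivative_of_degree_lt_succ (degree_modByMonic_nodePoly_lt F x i (n + 1)), eval_C,
    newtonCoeff, mul_div_cancel_left₀ _ (by positivity)]

/-! ### Repeated knots and Rolle's theorem. -/

/-- The knots up to index `j` that equal the `j`-th contribute this power. Hence the remainder and
the polynomial share the derivative required at that knot. -/
theorem pow_knotOrder_dvd_nodePoly (x : ℕ → ℝ) (i : ℕ) {n j : ℕ} (hj : j < n) :
    (X - C (x (i + j))) ^ (knotOrder (fun l => x (i + l)) j + 1) ∣ nodePoly x i n := by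
  classical
  have h1 : (X - C (x (i + j))) ^ (knotOrder (fun l => x (i + l)) j + 1) =
      ∏ l ∈ (Finset.range (j + 1)).filter (fun l => x (i + l) = x (i + j)),
        (X - C (x (i + l))) := by
    rw [Finset.prod_congr rfl fun l hl => by rw [(Finset.mem_filter.1 hl).2], Finset.prod_const,
      Finset.range_add_one, Finset.filter_insert, if_pos rfl, Finset.card_insert_of_notMem (by simp),
      knotOrder]
  rw [h1]
  refine Finset.prod_dvd_prod_of_subset _ _ _ fun l hl => ?_
  have := Finset.mem_range.1 (Finset.mem_filter.1 hl).1
  exact Finset.mem_range.2 (by omega)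

theorem knotOrder_le (y : ℕ → ℝ) (j : ℕ) : knotOrder y j ≤ j := by
  classical
  exact (Finset.card_filter_le _ _).trans (Finset.card_range j).le

theorem knotOrder_eq_zero {y : ℕ → ℝ} {j : ℕ} (h : ∀ l < j, y l ≠ y j) : knotOrder y j = 0 := by
  classical
  rw [knotOrder, Finset.card_eq_zero, Finset.filter_eq_empty_iff]
  exact fun l hl => h l (Finset.mem_range.1 hl)

theorem exists_knotOrder_eq_zero (y : ℕ → ℝ) (j : ℕ) :
    ∃ i ≤ j, y i = y j ∧ knotOrder y i = 0 := by
  classical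
  have h : ∃ i, y i = y j := ⟨j, rfl⟩
  refine ⟨Nat.find h, Nat.find_min' h rfl, Nat.find_spec h, knotOrder_eq_zero fun l hl => ?_⟩
  rw [Nat.find_spec h]
  exact Nat.find_min h hl

theorem le_of_chain {x : ℕ → ℝ} {m : ℕ} (h : ∀ j, j + 1 < m → x j ≤ x (j + 1)) {i j : ℕ}
    (hij : i ≤ j) (hj : j < m) : x i ≤ x j := by
  induction j, hij using Nat.le_induction with
  | base => exact le_rfl
  | succ j _ ih => exact (ih (by omega)).trans (h j hj)

/-- Rolle's theorem with multiplicities, for a sequence `G` of successive derivatives. -/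
theorem exists_eq_zero_of_knotOrder {a b : ℝ} (n : ℕ) : ∀ (G : ℕ → ℝ → ℝ) (y : ℕ → ℝ),
    (∀ l < n, ∀ t ∈ Set.Icc a b, HasDerivWithinAt (G l) (G (l + 1) t) (Set.Icc a b) t) →
    (∀ j, j + 1 < n + 1 → y j ≤ y (j + 1)) → a ≤ y 0 → y n ≤ b →
    (∀ j ≤ n, G (knotOrder y j) (y j) = 0) → ∃ ξ ∈ Set.Icc a b, G n ξ = 0 := by
  induction n with
  | zero =>
    intro G y _ _ ha hb h0
    exact ⟨y 0, ⟨ha, hb⟩, by simpa [knotOrder] using h0 0 le_rfl⟩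
  | succ n ih =>
    intro G y hG hy ha hb h0
    have hmono : ∀ {i j}, i ≤ j → j ≤ n + 1 → y i ≤ y j := fun hij hj =>
      le_of_chain hy hij (Nat.lt_succ_iff.2 hj)
    have hzero : ∀ j ≤ n + 1, G 0 (y j) = 0 := fun j hj => by
      obtain ⟨i, hij, hyij, hi⟩ := exists_knotOrder_eq_zero y j
      rw [← hyij, ← hi]
      exact h0 i (hij.trans hj)
    have hcont : ContinuousOn (G 0) (Set.Icc a b) := fun t ht =>
      (hG 0 n.succ_pos t ht).continuousWithinAt
    -- The new knots for `G 1`: a repeated knot is kept, a gap gives a Rolle point strictly inside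
    -- it.
    have hz : ∀ j, ∃ z, j ≤ n → y j ≤ z ∧ z ≤ y (j + 1) ∧
        (y j < y (j + 1) → y j < z ∧ z < y (j + 1) ∧ G 1 z = 0) := by
      intro j
      by_cases hj : j ≤ n
      swap
      · exact ⟨0, fun h => absurd h hj⟩
      rcases (hy j (by omega)).eq_or_lt with h | h
      · exact ⟨y j, fun _ => ⟨le_rfl, h.le, fun h' => absurd h h'.ne⟩⟩
      · have h1 : a ≤ y j := ha.trans (hmono (Nat.zero_le j) (by omega))
        have h2 : y (j + 1) ≤ b := (hmono (by omega) le_rfl).trans hb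
        obtain ⟨c, hc, hc0⟩ := exists_hasDerivAt_eq_zero (f := G 0) (f' := G 1) h
          (hcont.mono (Set.Icc_subset_Icc h1 h2))
          ((hzero j (by omega)).trans (hzero (j + 1) (by omega)).symm)
          fun t ht => (hG 0 n.succ_pos t ⟨h1.trans ht.1.le, ht.2.le.trans h2⟩).hasDerivAt
            (Icc_mem_nhds (h1.trans_lt ht.1) (ht.2.trans_le h2))
        exact ⟨c, fun _ => ⟨hc.1.le, hc.2.le, fun _ => ⟨hc.1, hc.2, hc0⟩⟩⟩
    choose z hz using hz
    refine ih (fun l => G (l + 1)) z (fun l hl => hG (l + 1) (by omega))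
      (fun j hj => (hz j (by omega)).2.1.trans (hz (j + 1) (by omega)).1)
      (ha.trans (hz 0 (Nat.zero_le n)).1) ((hz n le_rfl).2.1.trans hb) fun j hj => ?_
    rcases (hy j (by omega)).eq_or_lt with h | h
    · have hzj : z j = y j := le_antisymm (h ▸ (hz j hj).2.1) (hz j hj).1
      -- A kept knot loses exactly one multiplicity: Rolle points are interior to gaps and so never
      -- meet it.
      have hord : knotOrder y (j + 1) = knotOrder z j + 1 := by
        classical
        rw [knotOrder, Finset.range_add_one, Finset.filter_insert, if_pos h,
          Finset.card_insert_of_notMem (by simp), knotOrder]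
        congr 2
        refine Finset.filter_congr fun l hl => ?_
        have hlj : l < j := Finset.mem_range.1 hl
        have h3 : y (l + 1) ≤ y j := hmono hlj (by omega)
        obtain ⟨h4, h5, h6⟩ := hz l (by omega)
        rw [hzj, ← h]
        constructor
        · exact fun h7 => le_antisymm (h5.trans h3) (h7 ▸ h4)
        · intro h7
          by_contra h8
          have h9 : y l < y j := lt_of_le_of_ne (h7 ▸ h4) h8
          have h10 : y l < y (l + 1) := h9.trans_le (h7 ▸ h5)
          exact ((h6 h10).2.1.trans_le h3).ne h7
      have := h0 (j + 1) (by omega)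
      rw [hord, ← h, ← hzj] at this
      exact this
    · obtain ⟨h1, h2, h3⟩ := (hz j hj).2.2 h
      rw [knotOrder_eq_zero]
      · exact h3
      · intro l hl
        exact (((hz l (by omega)).2.1.trans (hmono hl (by omega))).trans_lt h1).ne

/-- A divided difference of order `n` is bounded by the derivative of order `n`. -/
theorem abs_newtonCoeff_le {a b E : ℝ} {n i : ℕ} {G : ℕ → ℝ → ℝ} {x : ℕ → ℝ} {F : ℝ[X]}
    (hG : ∀ l < n, ∀ t ∈ Set.Icc a b, HasDerivWithinAt (G l) (G (l + 1) t) (Set.Icc a b) t)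
    (hx : ∀ j, j < n → x (i + j) ≤ x (i + j + 1)) (ha : a ≤ x i) (hb : x (i + n) ≤ b)
    (hF : ∀ j ≤ n, ∀ l ≤ n, (derivative^[l] F).eval (x (i + j)) = G l (x (i + j)))
    (hE : ∀ t ∈ Set.Icc a b, |G n t| ≤ E) : |newtonCoeff F x n i| ≤ E := by
  set R := F %ₘ nodePoly x i (n + 1) with hR
  -- Rolle applies to the difference between `G` and the derivatives of the interpolant `R`, whose
  -- `n`-th derivative is the constant `n !` times the coefficient.
  obtain ⟨ξ, hξ, h0⟩ := exists_eq_zero_of_knotOrder (a := a) (b := b) n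
    (fun l t => G l t - (derivative^[l] R).eval t) (fun l => x (i + l))
    (fun l hl t ht => by
      rw [Function.iterate_succ_apply']
      exact (hG l hl t ht).sub ((derivative^[l] R).hasDerivWithinAt t _))
    (fun j hj => hx j (by omega)) ha hb (fun j hj => by
      have hle := (knotOrder_le (fun l => x (i + l)) j).trans hj
      rw [← hF j hj _ hle, sub_eq_zero]
      exact eval_iterate_derivative_eq_of_dvd
        ((pow_knotOrder_dvd_nodePoly x i (Nat.lt_succ_iff.2 hj)).trans
          (nodePoly_dvd_sub F x i (n + 1))))
  have h1 := hE ξ hξ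
  rw [sub_eq_zero.1 h0,
    iterate_derivative_of_degree_lt_succ (degree_modByMonic_nodePoly_lt F x i (n + 1)), eval_C,
    abs_mul, Nat.abs_cast] at h1
  refine le_trans (le_mul_of_one_le_left (abs_nonneg _) ?_) h1
  exact_mod_cast n.factorial_pos

/-! ### Polynomials with prescribed derivatives, and repeated integration. -/

theorem exists_polynomial_iterate_derivative (r : ℕ) (t : ℝ) : ∀ v : ℕ → ℝ,
    ∃ T : ℝ[X], ∀ l ≤ r, (derivative^[l] T).eval t = v l := by
  induction r with
  | zero => exact fun v => ⟨C (v 0), fun l hl => by simp [Nat.le_zero.1 hl]⟩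
  | succ r ih =>
    intro v
    obtain ⟨T, hT⟩ := ih fun l => v (l + 1)
    obtain ⟨P, -, hP, hPt⟩ := exists_antiderivative (k := T.natDegree + 1)
      (degree_le_natDegree.trans_lt (by exact_mod_cast Nat.lt_succ_self _)) t (v 0)
    refine ⟨P, fun l hl => ?_⟩
    rcases l with _ | l
    · exact hPt
    · rw [Function.iterate_succ_apply, hP]
      exact hT l (by omega)

/-- A polynomial with prescribed derivatives up to order `r` at finitely many points. -/
theorem exists_polynomial_iterate_derivative_finset (s : Finset ℝ) (r : ℕ) (v : ℕ → ℝ → ℝ) :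
    ∃ F : ℝ[X], ∀ t ∈ s, ∀ l ≤ r, (derivative^[l] F).eval t = v l t := by
  choose T hT using fun t : ℝ => exists_polynomial_iterate_derivative r t fun l => v l t
  -- Chinese remainder theorem for the coprime moduli `(X - C t) ^ (r + 1)`.
  have hcop : Pairwise (Function.onFun IsCoprime
      fun t : s => Ideal.span {(X - C (t : ℝ)) ^ (r + 1)}) := fun t u htu =>
    (Ideal.isCoprime_span_singleton_iff _ _).2
      (pairwise_coprime_X_sub_C Subtype.val_injective htu).pow
  obtain ⟨F, hF⟩ := Ideal.exists_forall_sub_mem_ideal hcop fun t => T t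
  refine ⟨F, fun t ht l hl => ?_⟩
  rw [← hT t l hl]
  have := Ideal.mem_span_singleton.1 (hF ⟨t, ht⟩)
  exact eval_iterate_derivative_eq_of_dvd ((pow_dvd_pow _ (by omega)).trans this)

/-- Repeated integration of a polynomial approximation of the `r`-th derivative. -/
theorem exists_polynomial_of_abs_deriv_sub_le {a b E : ℝ} {k : ℕ} {q : ℝ[X]} (hab : a ≤ b)
    (hE : 0 ≤ E) (hq : q.degree < k) (r : ℕ) : ∀ G : ℕ → ℝ → ℝ,
    (∀ l < r, ∀ t ∈ Set.Icc a b, HasDerivWithinAt (G l) (G (l + 1) t) (Set.Icc a b) t) →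
    (∀ t ∈ Set.Icc a b, |G r t - q.eval t| ≤ E) →
    ∃ Q : ℝ[X], Q.degree < ((k + r : ℕ) : WithBot ℕ) ∧ ∀ l ≤ r, ∀ t ∈ Set.Icc a b,
      |G l t - (derivative^[l] Q).eval t| ≤ E * (b - a) ^ (r - l) := by
  induction r with
  | zero =>
    refine fun G _ h => ⟨q, hq, fun l hl t ht => ?_⟩
    obtain rfl := Nat.le_zero.1 hl
    simpa using h t ht
  | succ r ih =>
    intro G hG h
    obtain ⟨Q', hQ', H⟩ := ih (fun l => G (l + 1)) (fun l hl => hG (l + 1) (by omega)) h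
    -- Matching the value at `a` makes each integration cost only a factor `b - a`.
    obtain ⟨Q, hQ, hQQ', hQa⟩ := exists_antiderivative hQ' a (G 0 a)
    refine ⟨Q, hQ, fun l hl t ht => ?_⟩
    rcases l with _ | l
    · have := norm_image_sub_le_of_norm_deriv_le_segment' (f := fun t => G 0 t - Q.eval t)
        (f' := fun t => G 1 t - Q'.eval t) (C := E * (b - a) ^ r)
        (fun t ht => (hG 0 r.succ_pos t ht).sub (hQQ' ▸ Q.hasDerivWithinAt t _))
        (fun t ht => H 0 (Nat.zero_le r) t ⟨ht.1, ht.2.le⟩) t ht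
      rw [hQa, sub_self, sub_zero, Real.norm_eq_abs] at this
      refine this.trans ?_
      rw [Nat.sub_zero, pow_succ, ← mul_assoc]
      exact mul_le_mul_of_nonneg_left (by linarith [ht.2])
        (mul_nonneg hE (pow_nonneg (sub_nonneg.2 hab) r))
    · rw [Function.iterate_succ_apply, hQQ', Nat.succ_sub_succ]
      exact H l (by omega) t ht

/-! ### Transfer from polynomials to `f`. -/

theorem hasDerivWithinAt_iteratedDerivWithin {f : ℝ → ℝ} {a b : ℝ} {r : ℕ} (hab : a < b)
    (hf : ContDiffOn ℝ (r : WithTop ℕ∞) f (Set.Icc a b)) {l : ℕ} (hl : l < r) {t : ℝ}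
    (ht : t ∈ Set.Icc a b) :
    HasDerivWithinAt (iteratedDerivWithin l f (Set.Icc a b))
      (iteratedDerivWithin (l + 1) f (Set.Icc a b) t) (Set.Icc a b) t := by
  rw [iteratedDerivWithin_succ]
  exact (hf.differentiableOn_iteratedDerivWithin (by exact_mod_cast hl) (uniqueDiffOn_Icc hab) t
    ht).hasDerivWithinAt

/-- The divided differences of `f` are those of any polynomial with the same Hermite data. -/
theorem dividedDiff_eq_newtonCoeff {f : ℝ → ℝ} {I : Set ℝ} {x : ℕ → ℝ} {m r : ℕ} {F : ℝ[X]}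
    (hmono : ∀ j, j + 1 < m → x j ≤ x (j + 1)) (hlt : ∀ j, j + r + 1 < m → x j < x (j + r + 1))
    (hF : ∀ j < m, ∀ l ≤ r, (derivative^[l] F).eval (x j) = iteratedDerivWithin l f I (x j))
    (n : ℕ) : ∀ i, i + n < m → dividedDiff f I x n i = newtonCoeff F x n i := by
  induction n with
  | zero =>
    intro i hi
    rw [newtonCoeff_zero, dividedDiff]
    simpa using (hF i hi 0 (Nat.zero_le r)).symm
  | succ n ih =>
    intro i hi
    by_cases h : x i = x (i + (n + 1))
    · rw [dividedDiff, if_pos h]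
      -- Knots `r + 1` places apart are distinct, so only derivatives of order at most `r` occur.
      have hn : n + 1 ≤ r := by
        by_contra hn
        have h1 := hlt i (by omega)
        have h2 : x (i + r + 1) ≤ x (i + (n + 1)) := le_of_chain hmono (by omega) hi
        linarith
      rw [← hF i (by omega) _ hn]
      refine (newtonCoeff_of_eq F fun l hl => le_antisymm ?_ ?_).symm
      · rw [h]; exact le_of_chain hmono (by omega) hi
      · exact le_of_chain hmono (by omega) (by omega)
    · rw [dividedDiff, if_neg h, newtonCoeff_succ_of_ne F h, ih i (by omega), ih (i + 1) (by omega)]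

/-- Earlier knots equal to `x j` must be among the `r` preceding ones, so the Hermite data stay
within the smoothness of `f`. -/
theorem knotOrder_le_of_lt {x : ℕ → ℝ} {m r j : ℕ} (hmono : ∀ j, j + 1 < m → x j ≤ x (j + 1))
    (hlt : ∀ j, j + r + 1 < m → x j < x (j + r + 1)) (hj : j < m) : knotOrder x j ≤ r := by
  classical
  have h : (Finset.range j).filter (fun i => x i = x j) ⊆ Finset.Ico (j - r) j := by
    intro i hi
    obtain ⟨h1, h2⟩ := Finset.mem_filter.1 hi
    have h1 := Finset.mem_range.1 h1
    rw [Finset.mem_Ico]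
    refine ⟨?_, h1⟩
    by_contra h3
    have h4 := hlt i (by omega)
    have h5 : x (i + r + 1) ≤ x j := le_of_chain hmono (by omega) hj
    linarith
  calc knotOrder x j = ((Finset.range j).filter (fun i => x i = x j)).card := by
        rw [knotOrder]
    _ ≤ (Finset.Ico (j - r) j).card := Finset.card_le_card h
    _ ≤ r := by rw [Nat.card_Ico]; omega

theorem hermitePoly_eq_modByMonic {f : ℝ → ℝ} {I : Set ℝ} {x : ℕ → ℝ} {m r : ℕ} {F : ℝ[X]}
    (hmono : ∀ j, j + 1 < m → x j ≤ x (j + 1)) (hlt : ∀ j, j + r + 1 < m → x j < x (j + r + 1))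
    (hF : ∀ j < m, ∀ l ≤ r, (derivative^[l] F).eval (x j) = iteratedDerivWithin l f I (x j)) :
    hermitePoly f I x m = F %ₘ nodePoly x 0 m := by
  rw [modByMonic_nodePoly_eq_sum, hermitePoly]
  refine Finset.sum_congr rfl fun j hj => ?_
  rw [dividedDiff_eq_newtonCoeff hmono hlt hF j 0 (by simpa using hj), nodePoly]
  simp only [zero_add]

theorem isHermiteInterpolant_hermitePoly {f : ℝ → ℝ} {I : Set ℝ} {x : ℕ → ℝ} {m r : ℕ} {F : ℝ[X]}
    (hmono : ∀ j, j + 1 < m → x j ≤ x (j + 1)) (hlt : ∀ j, j + r + 1 < m → x j < x (j + r + 1))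
    (hF : ∀ j < m, ∀ l ≤ r, (derivative^[l] F).eval (x j) = iteratedDerivWithin l f I (x j)) :
    IsHermiteInterpolant (hermitePoly f I x m) f I x m := by
  rw [hermitePoly_eq_modByMonic hmono hlt hF]
  refine ⟨degree_modByMonic_nodePoly_lt F x 0 m, fun j hj => ?_⟩
  rw [← hF j hj _ (knotOrder_le_of_lt hmono hlt hj)]
  have h := pow_knotOrder_dvd_nodePoly x 0 hj
  simp only [zero_add] at h
  exact (eval_iterate_derivative_eq_of_dvd (h.trans (nodePoly_dvd_sub F x 0 m))).symm

/-! ### Stability of Hermite interpolation. -/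

/-- Up to order `r` the derivative bound suffices. Beyond it the end knots are at least `lam` times
the length of the interval apart, and each use of the recursion costs a factor `2 / lam`. -/
theorem abs_newtonCoeff_mul_pow_le {x : ℕ → ℝ} {m r : ℕ} {lam E : ℝ} {F : ℝ[X]}
    {G : ℕ → ℝ → ℝ} (hlam₀ : 0 < lam) (hlam₁ : lam ≤ 1) (hE : 0 ≤ E)
    (hmono : ∀ j, j + 1 < m → x j ≤ x (j + 1)) (hI : x 0 < x (m - 1))
    (hsep : ∀ j, j + r + 1 < m → lam * (x (m - 1) - x 0) ≤ x (j + r + 1) - x j)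
    (hG : ∀ l < r, ∀ t ∈ Set.Icc (x 0) (x (m - 1)),
      HasDerivWithinAt (G l) (G (l + 1) t) (Set.Icc (x 0) (x (m - 1))) t)
    (hF : ∀ j < m, ∀ l ≤ r, (derivative^[l] F).eval (x j) = G l (x j))
    (hGE : ∀ l ≤ r, ∀ t ∈ Set.Icc (x 0) (x (m - 1)),
      |G l t| ≤ E * (x (m - 1) - x 0) ^ (r - l)) (n : ℕ) :
    ∀ i, i + n < m → |newtonCoeff F x n i| * (x (m - 1) - x 0) ^ n ≤
      (2 / lam) ^ n * (E * (x (m - 1) - x 0) ^ r) := by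
  set L := x (m - 1) - x 0 with hL
  have hL0 : 0 < L := sub_pos.2 hI
  have hlam : 1 ≤ 2 / lam := (one_le_div hlam₀).2 (by linarith)
  have hsmall : ∀ n ≤ r, ∀ i, i + n < m →
      |newtonCoeff F x n i| * L ^ n ≤ (2 / lam) ^ n * (E * L ^ r) := by
    intro n hn i hi
    have h := abs_newtonCoeff_le (F := F) (n := n) (fun l hl => hG l (by omega))
      (fun j hj => hmono (i + j) (by omega)) (le_of_chain hmono (Nat.zero_le i) (by omega))
      (le_of_chain hmono (by omega) (by omega))
      (fun j hj l hl => hF (i + j) (by omega) l (by omega)) (hGE n hn)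
    calc |newtonCoeff F x n i| * L ^ n ≤ E * L ^ (r - n) * L ^ n := by gcongr
      _ = E * L ^ r := by rw [mul_assoc, pow_sub_mul_pow _ hn]
      _ ≤ (2 / lam) ^ n * (E * L ^ r) :=
        le_mul_of_one_le_left (by positivity) (one_le_pow₀ hlam)
  induction n with
  | zero => exact hsmall 0 (Nat.zero_le r)
  | succ n ih =>
    rcases Nat.lt_or_ge r (n + 1) with hr | hr
    · intro i hi
      have h1 : lam * L ≤ x (i + (n + 1)) - x i := (hsep i (by omega)).trans
        (sub_le_sub_right (le_of_chain hmono (by omega) hi) _)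
      have hpos : 0 < lam * L := by positivity
      have hpos' : 0 < x (i + (n + 1)) - x i := hpos.trans_le h1
      rw [newtonCoeff_succ_of_ne F (sub_pos.1 hpos').ne, abs_div, abs_of_pos hpos']
      have h2 := ih i (by omega)
      have h3 := ih (i + 1) (by omega)
      have h4 : |newtonCoeff F x n (i + 1) - newtonCoeff F x n i| * L ^ n ≤
          2 * ((2 / lam) ^ n * (E * L ^ r)) := by
        refine (mul_le_mul_of_nonneg_right (abs_sub _ _) (by positivity)).trans ?_
        rw [add_mul]; linarith
      calc |newtonCoeff F x n (i + 1) - newtonCoeff F x n i| / (x (i + (n + 1)) - x i) * L ^ (n + 1)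
          ≤ |newtonCoeff F x n (i + 1) - newtonCoeff F x n i| / (lam * L) * L ^ (n + 1) := by gcongr
        _ = |newtonCoeff F x n (i + 1) - newtonCoeff F x n i| * L ^ n / lam := by
          field_simp
          ring
        _ ≤ 2 * ((2 / lam) ^ n * (E * L ^ r)) / lam := by gcongr
        _ = (2 / lam) ^ (n + 1) * (E * L ^ r) := by ring
    · exact hsmall (n + 1) hr

/-- In Newton's form each factor `t - x l` is at most the length of the interval. -/
theorem abs_eval_modByMonic_nodePoly_le {x : ℕ → ℝ} {m : ℕ} {c K : ℝ} {F : ℝ[X]} (hc : 1 ≤ c)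
    (hK : 0 ≤ K) (hmono : ∀ j, j + 1 < m → x j ≤ x (j + 1))
    (h : ∀ j < m, |newtonCoeff F x j 0| * (x (m - 1) - x 0) ^ j ≤ c ^ j * K) {t : ℝ}
    (ht : t ∈ Set.Icc (x 0) (x (m - 1))) :
    |(F %ₘ nodePoly x 0 m).eval t| ≤ m * c ^ m * K := by
  rw [modByMonic_nodePoly_eq_sum, eval_finsetSum]
  refine (Finset.abs_sum_le_sum_abs _ _).trans ?_
  rw [mul_assoc, ← nsmul_eq_mul]
  nth_rewrite 2 [← Finset.card_range m]
  refine Finset.sum_le_card_nsmul _ _ _ fun j hj => ?_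
  have hj : j < m := Finset.mem_range.1 hj
  have hN : |(nodePoly x 0 j).eval t| ≤ (x (m - 1) - x 0) ^ j := by
    rw [nodePoly, eval_prod, Finset.abs_prod]
    refine (Finset.prod_le_prod (fun _ _ => abs_nonneg _)
      (g := fun _ => x (m - 1) - x 0) fun l hl => ?_).trans_eq (by simp)
    have hl : l < j := Finset.mem_range.1 hl
    have h1 : x 0 ≤ x (0 + l) := le_of_chain hmono (by omega) (by omega)
    have h2 : x (0 + l) ≤ x (m - 1) := le_of_chain hmono (by omega) (by omega)
    rw [eval_sub, eval_X, eval_C, abs_le]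
    constructor <;> linarith [ht.1, ht.2]
  rw [eval_mul, eval_C, abs_mul]
  calc _ ≤ |newtonCoeff F x j 0| * (x (m - 1) - x 0) ^ j :=
        mul_le_mul_of_nonneg_left hN (abs_nonneg _)
    _ ≤ c ^ j * K := h j hj
    _ ≤ c ^ m * K := mul_le_mul_of_nonneg_right (pow_le_pow_right₀ hc hj.le) hK

end WhitneyHermite

/-! ### The main theorem. -/

/-- The knots are the first `m` terms `x 0, …, x (m - 1)` of the sequence `x`;
`I = [x 0, x (m - 1)]` is their (nondegenerate) hull. -/
theorem theorem2 (m : ℕ) (lam : ℝ) (hlam₀ : 0 < lam) (hlam₁ : lam ≤ 1) :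
    ∃ C : ℝ, 0 < C ∧
      ∀ (r : ℕ) (_hm : r + 2 ≤ m) (x : ℕ → ℝ)
        (_hmono : ∀ j : ℕ, j + 1 < m → x j ≤ x (j + 1))
        (_hI : x 0 < x (m - 1))
        (_hsep : ∀ j : ℕ, j + r + 1 < m → lam * (x (m - 1) - x 0) ≤ x (j + r + 1) - x j)
        (f : ℝ → ℝ) (_hf : ContDiffOn ℝ (r : WithTop ℕ∞) f (Set.Icc (x 0) (x (m - 1)))),
        WhitneyHermite.IsHermiteInterpolant
            (WhitneyHermite.hermitePoly f (Set.Icc (x 0) (x (m - 1))) x m)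
            f (Set.Icc (x 0) (x (m - 1))) x m ∧
          ∀ t ∈ Set.Icc (x 0) (x (m - 1)),
            |f t - (WhitneyHermite.hermitePoly f (Set.Icc (x 0) (x (m - 1))) x m).eval t| ≤
              C * (x (m - 1) - x 0) ^ r *
                WhitneyHermite.modulus (m - r)
                  (iteratedDerivWithin r f (Set.Icc (x 0) (x (m - 1))))
                  (x (m - 1) - x 0) (x 0) (x (m - 1)) := by
  choose W hW0 hW using fun k : ℕ =>
    WhitneyHermite.exists_polynomial_abs_sub_le_modulus (Nat.succ_pos k)
  have hWsum : 0 ≤ ∑ k ∈ Finset.range m, W k := Finset.sum_nonneg fun k _ => hW0 k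
  -- `W k` is the Whitney constant of order `k + 1`. Summing over `k < m` covers the order `m - r`
  -- for every admissible `r`, so the constant does not depend on `r`.
  refine ⟨(1 + m * (2 / lam) ^ m) * (1 + ∑ k ∈ Finset.range m, W k), by positivity, ?_⟩
  intro r hm x hmono hI hsep f hf
  set L := x (m - 1) - x 0 with hL
  set I := Set.Icc (x 0) (x (m - 1)) with hIdef
  have hL0 : 0 < L := sub_pos.2 hI
  have hlt : ∀ j, j + r + 1 < m → x j < x (j + r + 1) := fun j hj =>
    sub_pos.1 ((mul_pos hlam₀ hL0).trans_le (hsep j hj))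
  obtain ⟨F, hF⟩ := WhitneyHermite.exists_polynomial_iterate_derivative_finset
    ((Finset.range m).image x) r fun l t => iteratedDerivWithin l f I t
  replace hF : ∀ j < m, ∀ l ≤ r, (Polynomial.derivative^[l] F).eval (x j) =
      iteratedDerivWithin l f I (x j) := fun j hj =>
    hF (x j) (Finset.mem_image_of_mem x (Finset.mem_range.2 hj))
  refine ⟨WhitneyHermite.isHermiteInterpolant_hermitePoly hmono hlt hF, fun t ht => ?_⟩
  have hG : ∀ l < r, ∀ t ∈ I, HasDerivWithinAt (iteratedDerivWithin l f I)
      (iteratedDerivWithin (l + 1) f I t) I t := fun l hl t ht =>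
    WhitneyHermite.hasDerivWithinAt_iteratedDerivWithin hI hf hl ht
  have hcont : ContinuousOn (iteratedDerivWithin r f I) I :=
    hf.continuousOn_iteratedDerivWithin le_rfl (uniqueDiffOn_Icc hI)
  obtain ⟨q, hq, hfq⟩ := hW (m - r - 1) _ _ _ hI hcont
  have hk : (m - r - 1).succ = m - r := by omega
  rw [hk] at hq hfq
  set Ω := WhitneyHermite.modulus (m - r) (iteratedDerivWithin r f I) L (x 0) (x (m - 1)) with hΩ
  have hΩ0 : 0 ≤ Ω := WhitneyHermite.modulus_nonneg _ _ _ _ _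
  set E := W (m - r - 1) * Ω with hE
  have hE0 : 0 ≤ E := mul_nonneg (hW0 _) hΩ0
  obtain ⟨Q, hQ, hfQ⟩ := WhitneyHermite.exists_polynomial_of_abs_deriv_sub_le hI.le hE0 hq r
    (fun l => iteratedDerivWithin l f I) hG hfq
  rw [Nat.sub_add_cancel (by omega)] at hQ
  -- `F - Q` carries the Hermite data of `f - Q`.
  have hcoeff := WhitneyHermite.abs_newtonCoeff_mul_pow_le (F := F - Q)
    (G := fun l t => iteratedDerivWithin l f I t - (Polynomial.derivative^[l] Q).eval t)
    hlam₀ hlam₁ hE0 hmono hI hsep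
    (fun l hl t ht => by
      rw [Function.iterate_succ_apply']
      exact (hG l hl t ht).sub ((Polynomial.derivative^[l] Q).hasDerivWithinAt t _))
    (fun j hj l hl => by
      rw [Polynomial.iterate_derivative_sub, Polynomial.eval_sub, hF j hj l hl])
    hfQ
  have hbound := WhitneyHermite.abs_eval_modByMonic_nodePoly_le (F := F - Q)
    ((one_le_div hlam₀).2 (by linarith)) (mul_nonneg hE0 (pow_nonneg hL0.le r)) hmono
    (fun j hj => hcoeff j 0 (by omega)) ht
  -- Interpolation reproduces `Q`, whose degree is less than `m`.
  have hmod : (F - Q) %ₘ WhitneyHermite.nodePoly x 0 m =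
      WhitneyHermite.hermitePoly f I x m - Q := by
    rw [WhitneyHermite.hermitePoly_eq_modByMonic hmono hlt hF]
    refine WhitneyHermite.modByMonic_nodePoly_eq ?_ ?_
    · exact (Polynomial.degree_sub_le _ _).trans_lt
        (max_lt (WhitneyHermite.degree_modByMonic_nodePoly_lt F x 0 m) hQ)
    · rw [sub_sub_sub_cancel_right]
      exact WhitneyHermite.nodePoly_dvd_sub F x 0 m
  rw [hmod, Polynomial.eval_sub] at hbound
  have h0 : |f t - Q.eval t| ≤ E * L ^ r := by
    simpa using hfQ 0 (Nat.zero_le r) t ht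
  have hEW : E ≤ (1 + ∑ k ∈ Finset.range m, W k) * Ω := by
    refine mul_le_mul_of_nonneg_right ?_ hΩ0
    have := Finset.single_le_sum (f := W) (fun k _ => hW0 k)
      (Finset.mem_range.2 (show m - r - 1 < m by omega))
    linarith
  calc |f t - (WhitneyHermite.hermitePoly f I x m).eval t|
      ≤ |f t - Q.eval t| + |(WhitneyHermite.hermitePoly f I x m).eval t - Q.eval t| := by
        rw [abs_sub_comm ((WhitneyHermite.hermitePoly f I x m).eval t)]
        exact abs_sub_le _ _ _
    _ ≤ E * L ^ r + m * (2 / lam) ^ m * (E * L ^ r) := add_le_add h0 hbound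
    _ = (1 + m * (2 / lam) ^ m) * L ^ r * E := by ring
    _ ≤ (1 + m * (2 / lam) ^ m) * L ^ r * ((1 + ∑ k ∈ Finset.range m, W k) * Ω) :=
        mul_le_mul_of_nonneg_left hEW (by positivity)
    _ = (1 + m * (2 / lam) ^ m) * (1 + ∑ k ∈ Finset.range m, W k) * L ^ r * Ω := by ring
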